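/- A formal context $\mathbb K=(G,M,I)$ consists of a set $G$ of objects, a set $M$ of attributes and a relation $I\subseteq G\times M$; its formal concepts are the pairs $(A,B)$ with $A\subseteq G$, $B\subseteq M$, $B=\{n\in M: (h,n)\in I\ \text{for all } h\in A\}$ and $A=\{h\in G: (h,n)\in I\ \text{for all } n\in B\}$, and $\mathfrak B(\mathbb K)$ denotes the set of all of them. For $g\in G$ and $m\in M$ let $$op^{g,m}(\mathbb K)=(G,M,J),\qquad J=I\cup\{(g,n): n\in M\setminus\{m\}\}\cup\{(h,m): h\in G\setminus\{g\}\},$$ let $\mathbb K_{-g-m}=(G\setminus\{g\},\,M\setminus\{m\},\,I\cap((G\setminus\{g\})\times(M\setminus\{m\})))$, and call $\mathbb K_{-g-m}$ rich if $|\mathfrak B(\mathbb K_{-g-m})|\ge\frac12|\mathfrak B(\mathbb K)|$. Let $\mathbb K=(G,M,I)$ be a formal context with finite $G$ ($M$ may be infinite). 1. For every attribute $m\in M$ that is not a full column (that is, $(h,m)\notin I$ for some $h\in G$), there exists an object $g\in G$ with $(g,m)\notin I$ such that $|\mathfrak B(op^{g,m}(\mathbb K))|\ge|\mathfrak B(\mathbb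 K)|$ and $\mathbb K_{-g-m}$ is rich. 2. In particular, if $I\ne G\times M$, then there is a pair $(g,m)\in (G\times M)\setminus I$ such that $\mathbb K_{-g-m}$ is rich. -/

import Mathlib

/-! A formal context `(G, M, I)` is given by a type `G` of objects, a type `M` of attributes and an
incidence relation `I : G → M → Prop`. Its formal concepts are the elements of Mathlib's
`Concept G M I`. -/

namespace FormalContext

/-- A context with finitely many objects has finitely many concepts, since a concept is determined
by its extent. Hence the number of concepts below is a genuine cardinality. -/
instance finite_concept {G M : Type*} [Finite G] (I : G → M → Prop) : Finite (Concept G M I) :=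
  Finite.of_injective (fun c : Concept G M I => c.extent) Concept.extent_injective

/-- The number of formal concepts of the context `(G, M, I)`. -/
noncomputable def numConcepts {G M : Type*} (I : G → M → Prop) : ℕ :=
  Nat.card (Concept G M I)

/-- The attribute `m` is a full column: every object has it. -/
def IsFullColumn {G M : Type*} (I : G → M → Prop) (m : M) : Prop :=
  ∀ g : G, I g m

/-- The incidence relation
`J = I ∪ {(g, n) | n ∈ M \ {m}} ∪ {(h, m) | h ∈ G \ {g}}` of `op^{g,m}(G, M, I) = (G, M, J)`. -/
def op {G M : Type*} (I : G → M → Prop) (g : G) (m : M) : G → M → Prop :=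
  fun h n => I h n ∨ (h = g ∧ n ≠ m) ∨ (h ≠ g ∧ n = m)

/-- The incidence relation of the subcontext obtained by deleting the object `g` and the
attribute `m`: its objects are `G \ {g}`, its attributes are `M \ {m}`. -/
def delete {G M : Type*} (I : G → M → Prop) (g : G) (m : M) :
    {h : G // h ≠ g} → {n : M // n ≠ m} → Prop :=
  fun h n => I h.1 n.1

/-- The subcontext obtained by deleting `g` and `m` is rich: it has at least half as many concepts
as the whole context. -/
def IsRich {G M : Type*} (I : G → M → Prop) (g : G) (m : M) : Prop :=
  (numConcepts (delete I g m) : ℚ) ≥ 1 / 2 * (numConcepts I : ℚ)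

end FormalContext

/-! Let `A` be the set of objects having the attribute `m`, and let `𝓕` be the family of extents of
the context without the column `m`. The extents of `(G, M, I)` are the members of `𝓕` together with
their traces on `A`; deleting `g` as well replaces every `F ∈ 𝓕` by `F \ {g}`. For `g ∉ A`, the
extents of `op^{g,m}` are the sets `F \ {g}` and `F ∪ {g}` with `F ∈ 𝓕`, so that `op^{g,m}` has
exactly twice as many concepts as the subcontext without `g` and `m`. Both assertions about `g`
therefore say that `2 |{F \ {g} : F ∈ 𝓕}| ≥ |𝓕 ∪ {F ∩ A : F ∈ 𝓕}|`.

This inequality is proved for an arbitrary finite family of subsets of a finite set, by averaging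
over `g ∉ A`. Call `F ∈ 𝓕` unpaired in direction `g` if `F ∆ {g} ∉ 𝓕`. The left side is `|𝓕|` plus
the number of members that are unpaired in direction `g` (`card_add_card_unpaired_le`), and the right
side is `|𝓕|` plus the number of traces on `A` outside `𝓕`. Since flipping `g ∉ A` does not change
the trace on `A`, it is enough that the fibre over each such trace has, summed over `g ∉ A`, at least
`|Aᶜ|` unpaired members. In a fibre over a trace outside `𝓕` a minimal member is unpaired in some
direction. If `r` of the `k = |Aᶜ|` directions leave the fibre invariant, then in each of the others an
unpaired member yields `r + 1` of them, by flipping it along one invariant direction at a time, and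
`(k - r) (r + 1) ≥ k` because `r < k` (`card_le_sum_card_unpaired`). -/

namespace FormalContext

open Finset
open scoped symmDiff Classical

/-! ### Unpaired members of a family of sets -/

/-- The members of the family `𝓕` that leave it when the element `g` is flipped. -/
noncomputable def unpaired {α : Type*} (𝓕 : Finset (Set α)) (g : α) : Finset (Set α) :=
  {F ∈ 𝓕 | F ∆ {g} ∉ 𝓕}

theorem symmDiff_singleton_of_mem {α : Type*} {F : Set α} {g : α} (h : g ∈ F) :
    F ∆ {g} = F \ {g} := by
  ext x; simp only [Set.mem_symmDiff, Set.mem_singleton_iff, Set.mem_sdiff]; grind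

theorem symmDiff_singleton_inter {α : Type*} {A : Set α} {g : α} (hg : g ∉ A) (F : Set α) :
    F ∆ {g} ∩ A = F ∩ A := by
  ext x; simp only [Set.mem_inter_iff, Set.mem_symmDiff, Set.mem_singleton_iff]; grind

/-- If a family is not invariant under all flips along `X`, then on average over `X` it has at least
one unpaired member. -/
theorem card_le_sum_card_unpaired {α : Type*} {L : Finset (Set α)} {X : Finset α} {g₀ : α}
    (hg₀ : g₀ ∈ X) (hL : (unpaired L g₀).Nonempty) :
    #X ≤ ∑ g ∈ X, #(unpaired L g) := by
  set R : Finset α := {g ∈ X | unpaired L g = ∅} with hR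
  have hinv : ∀ h ∈ R, ∀ F ∈ L, F ∆ {h} ∈ L := by
    intro h hh F hF
    by_contra hc
    have : F ∈ unpaired L h := by simp [unpaired, hF, hc]
    simp [(mem_filter.1 hh).2] at this
  have hlow : ∀ g ∈ X \ R, #R + 1 ≤ #(unpaired L g) := by
    intro g hg
    obtain ⟨F, hF⟩ : (unpaired L g).Nonempty := by
      rw [nonempty_iff_ne_empty]; grind
    have hF' := hF
    simp only [unpaired, mem_filter] at hF'
    have hinj : Function.Injective fun h : α => F ∆ {h} := fun a b hab =>
      Set.singleton_injective (symmDiff_right_injective F hab)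
    have hnot : F ∉ R.image fun h => F ∆ {h} := by
      simp only [mem_image, not_exists, not_and]
      intro h _ he
      rw [symmDiff_eq_left] at he
      exact Set.singleton_ne_empty h he
    rw [← card_image_of_injective R hinj, ← card_insert_of_notMem hnot]
    refine card_le_card fun S hS => ?_
    rcases mem_insert.1 hS with rfl | hS
    · exact hF
    · obtain ⟨h, hh, rfl⟩ := mem_image.1 hS
      refine mem_filter.2 ⟨hinv h hh F hF'.1, fun hc => hF'.2 ?_⟩
      -- Flips commute and are involutions, so flipping `h` again would bring `F ∆ {g}` into `L`.
      have := hinv h hh _ hc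
      rwa [symmDiff_right_comm, symmDiff_symmDiff_cancel_right] at this
  have hRX : R ⊆ X := filter_subset _ _
  have hlt : #R < #X := card_lt_card ⟨hRX, fun h => by
    have := (mem_filter.1 (h hg₀)).2
    simp [this] at hL⟩
  -- With `#X = #R + d + 1` the first step reads `#R + d + 1 ≤ (d + 1) * (#R + 1)`.
  calc #X ≤ #(X \ R) * (#R + 1) := by
        rw [card_sdiff_of_subset hRX]
        obtain ⟨d, hd⟩ := Nat.exists_eq_add_of_lt hlt
        rw [hd, show #R + d + 1 - #R = d + 1 by omega]
        nlinarith [Nat.zero_le (d * #R)]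
    _ ≤ ∑ g ∈ X \ R, #(unpaired L g) := by
        simpa using Finset.card_nsmul_le_sum (X \ R) _ _ hlow
    _ ≤ ∑ g ∈ X, #(unpaired L g) := sum_le_sum_of_subset sdiff_subset

/-- Deleting `g` from all members merges exactly the pairs `F`, `F ∆ {g}` inside the family, so each
remaining set accounts for one such pair or for one unpaired member, which the left side counts
twice. -/
theorem card_add_card_unpaired_le {α : Type*} (𝓕 : Finset (Set α)) (g : α) :
    #𝓕 + #(unpaired 𝓕 g) ≤ 2 * #(𝓕.image (· \ {g})) := by
  have h1 := card_eq_sum_card_image (· \ {g}) 𝓕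
  have h2 : #(unpaired 𝓕 g) =
      ∑ S ∈ 𝓕.image (· \ {g}), #{F ∈ unpaired 𝓕 g | F \ {g} = S} :=
    card_eq_sum_card_fiberwise fun F hF =>
      mem_image_of_mem _ (mem_filter.1 hF).1
  rw [h1, h2, ← sum_add_distrib, mul_comm, ← smul_eq_mul]
  refine sum_le_card_nsmul _ _ _ fun S hS => ?_
  obtain ⟨F₀, hF₀, rfl⟩ := mem_image.1 hS
  -- The fibre is either `{F₀}`, unpaired, or `{F₀, F₀ ∆ {g}}` without unpaired members.
  have hcases : ∀ F : Set α, F \ {g} = F₀ \ {g} → F = F₀ ∨ F = F₀ ∆ {g} := by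
    intro F hF
    by_cases hg : (g ∈ F ↔ g ∈ F₀)
    · left; ext x
      have := Set.ext_iff.1 hF x
      simp only [Set.mem_sdiff, Set.mem_singleton_iff] at this
      grind
    · right; ext x
      have := Set.ext_iff.1 hF x
      simp only [Set.mem_sdiff, Set.mem_singleton_iff] at this
      simp only [Set.mem_symmDiff, Set.mem_singleton_iff]
      grind
  by_cases hp : F₀ ∆ {g} ∈ 𝓕
  · have e1 : {F ∈ 𝓕 | F \ {g} = F₀ \ {g}} ⊆ {F₀, F₀ ∆ {g}} := by
      intro F hF
      simpa using hcases F (mem_filter.1 hF).2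
    have e2 : {F ∈ unpaired 𝓕 g | F \ {g} = F₀ \ {g}} = ∅ := by
      refine filter_eq_empty_iff.2 fun F hF he => ?_
      obtain ⟨hF, hn⟩ := mem_filter.1 hF
      rcases hcases F he with rfl | rfl
      · exact hn hp
      · rw [symmDiff_symmDiff_cancel_right] at hn
        exact hn hF₀
    rw [e2, card_empty, add_zero]
    exact (card_le_card e1).trans card_le_two
  · have e1 : {F ∈ 𝓕 | F \ {g} = F₀ \ {g}} ⊆ {F₀} := by
      intro F hF
      obtain ⟨hF, he⟩ := mem_filter.1 hF
      rcases hcases F he with rfl | rfl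
      · simp
      · exact absurd hF hp
    have e2 : {F ∈ unpaired 𝓕 g | F \ {g} = F₀ \ {g}} ⊆ {F₀} :=
      (filter_subset_filter _ (filter_subset _ _)).trans e1
    have := card_le_card e1
    have := card_le_card e2
    simp only [card_singleton] at *
    omega

/-! ### Deleting one element versus adding all traces -/

/-- For each trace on `A` outside the family, its fibre has on average over `g ∉ A` at least one
unpaired member. -/
theorem card_compl_mul_card_new_traces_le {α : Type*} [Fintype α] (𝓕 : Finset (Set α))
    (A : Set α) :
    #(Aᶜ).toFinset * #(𝓕.image (· ∩ A) \ 𝓕) ≤ ∑ g ∈ (Aᶜ).toFinset, #(unpaired 𝓕 g) := by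
  set X := (Aᶜ).toFinset with hX
  set N := 𝓕.image (· ∩ A) \ 𝓕 with hN
  have hfib : ∀ g ∈ X, ∑ T ∈ N, #(unpaired {F ∈ 𝓕 | F ∩ A = T} g) ≤ #(unpaired 𝓕 g) := by
    intro g hg
    have hgA : g ∉ A := by simpa [hX] using hg
    have : ∀ T, unpaired {F ∈ 𝓕 | F ∩ A = T} g = {F ∈ unpaired 𝓕 g | F ∩ A = T} := by
      intro T; ext F
      simp only [unpaired, mem_filter, symmDiff_singleton_inter hgA]; tauto
    simp only [this]
    rw [sum_card_fiberwise_eq_card_filter]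
    exact card_filter_le _ _
  refine le_trans ?_ (sum_le_sum hfib)
  rw [sum_comm, mul_comm, ← smul_eq_mul]
  refine card_nsmul_le_sum _ _ _ fun T hT => ?_
  obtain ⟨hT, hT'⟩ := mem_sdiff.1 hT
  obtain ⟨F, hF, hFT⟩ := mem_image.1 hT
  obtain ⟨F₀, hF₀⟩ := exists_minimal (s := {F ∈ 𝓕 | F ∩ A = T}) ⟨F, by simp [hF, hFT]⟩
  obtain ⟨hF₀F, hF₀T⟩ := mem_filter.1 hF₀.prop
  obtain ⟨g, hgF, hgA⟩ : ∃ g ∈ F₀, g ∉ A := by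
    by_contra! hc
    exact hT' (hF₀T ▸ (Set.inter_eq_left.2 hc).symm ▸ hF₀F)
  refine card_le_sum_card_unpaired (g₀ := g) (by simpa [hX] using hgA)
    ⟨F₀, mem_filter.2 ⟨hF₀.prop, fun hc => ?_⟩⟩
  rw [symmDiff_singleton_of_mem hgF] at hc
  exact (hF₀.le_of_le hc Set.sdiff_subset hgF).2 rfl

/-- The combinatorial core: adding all traces on a proper subset `A` to a family gives at most twice
as many sets as deleting a suitable element `g ∉ A` from all its members. The family need not be
closed under intersections. -/
theorem exists_card_union_traces_le {α : Type*} [Finite α] (𝓕 : Set (Set α)) {A : Set α}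
    (hA : A ≠ Set.univ) :
    ∃ g ∉ A, (𝓕 ∪ (· ∩ A) '' 𝓕).ncard ≤ 2 * ((· \ {g}) '' 𝓕).ncard := by
  have := Fintype.ofFinite α
  lift 𝓕 to Finset (Set α) using 𝓕.toFinite
  have hne : (Aᶜ).toFinset.Nonempty :=
    Set.toFinset_nonempty.2 (Set.nonempty_compl.2 hA)
  obtain ⟨g, hg, hle⟩ := exists_le_of_sum_le hne (f := fun _ => #(𝓕.image (· ∩ A) \ 𝓕))
    (g := fun g => #(unpaired 𝓕 g))
    (by simpa using card_compl_mul_card_new_traces_le 𝓕 A)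
  refine ⟨g, by simpa using hg, ?_⟩
  have h1 := card_add_card_unpaired_le 𝓕 g
  have h2 : #(𝓕 ∪ 𝓕.image (· ∩ A)) = #𝓕 + #(𝓕.image (· ∩ A) \ 𝓕) := by
    rw [← union_sdiff_self_eq_union, card_union_of_disjoint disjoint_sdiff]
  rw [← coe_image, ← coe_image, ← coe_union, Set.ncard_coe_finset, Set.ncard_coe_finset]
  omega

/-! ### Extents of the contexts involved -/

/-- The incidence relation of the context without the attribute `m`. -/
def deleteAttribute {G M : Type*} (I : G → M → Prop) (m : M) : G → {n : M // n ≠ m} → Prop :=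
  fun h n => I h n

/-- The set of extents of the context `(G, M, I)`. -/
def extents {G M : Type*} (I : G → M → Prop) : Set (Set G) :=
  Set.range (lowerPolar I)

theorem numConcepts_eq_ncard_extents {G M : Type*} (I : G → M → Prop) :
    numConcepts I = (extents I).ncard := by
  have : extents I = Set.range (Concept.extent : Concept G M I → Set G) := by
    ext s
    exact Concept.isExtent_iff_exists_concept
  rw [this, numConcepts, ← Set.image_univ, Set.ncard_image_of_injective _ Concept.extent_injective,
    Set.ncard_univ]

theorem extents_eq_union_traces {G M : Type*} (I : G → M → Prop) (m : M) :
    extents I = extents (deleteAttribute I m) ∪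
      (· ∩ {h | I h m}) '' extents (deleteAttribute I m) := by
  have hpol (t : Set M) : lowerPolar (deleteAttribute I m) (Subtype.val ⁻¹' t) =
      lowerPolar I (t \ {m}) := by
    ext h
    simp only [mem_lowerPolar_iff, deleteAttribute, Set.mem_preimage, Subtype.forall, Set.mem_sdiff,
      Set.mem_singleton_iff]
    grind
  have hpol' (t : Set {n : M // n ≠ m}) : lowerPolar (deleteAttribute I m) t =
      lowerPolar I (Subtype.val '' t) := by
    ext h
    simp only [mem_lowerPolar_iff, deleteAttribute, Set.mem_image]
    grind
  apply Set.Subset.antisymm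
  · rintro _ ⟨t, rfl⟩
    by_cases hm : m ∈ t
    · refine Or.inr ⟨_, ⟨Subtype.val ⁻¹' t, rfl⟩, ?_⟩
      simp only [hpol]
      ext h
      simp only [mem_lowerPolar_iff, Set.mem_inter_iff, Set.mem_sdiff, Set.mem_singleton_iff,
        Set.mem_ofPred_eq]
      grind
    · exact Or.inl ⟨Subtype.val ⁻¹' t, by rw [hpol, Set.sdiff_singleton_eq_self hm]⟩
  · rintro _ (⟨t, rfl⟩ | ⟨_, ⟨t, rfl⟩, rfl⟩)
    · exact ⟨_, (hpol' t).symm⟩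
    · refine ⟨Subtype.val '' t ∪ {m}, ?_⟩
      simp only [lowerPolar_union, hpol']
      congr 1
      ext h
      simp

theorem numConcepts_delete {G M : Type*} (I : G → M → Prop) (g : G) (m : M) :
    numConcepts (delete I g m) = ((· \ {g}) '' extents (deleteAttribute I m)).ncard := by
  rw [numConcepts_eq_ncard_extents, ← Set.ncard_image_of_injective _
    (Set.image_injective.2 Subtype.val_injective)]
  congr 1
  simp only [extents, ← Set.range_comp]
  congr 1
  ext t h
  simp only [Function.comp_apply, Set.mem_image, mem_lowerPolar_iff, delete, deleteAttribute,
    Set.mem_sdiff, Set.mem_singleton_iff, Subtype.exists]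
  constructor
  · rintro ⟨a, ha, hat, rfl⟩
    exact ⟨hat, ha⟩
  · rintro ⟨hht, hh⟩
    exact ⟨h, hh, hht, rfl⟩

/-- The concept lattice of `op^{g,m}` is two copies of that of the subcontext without `g` and `m`:
every extent of the latter yields one extent with `g` and one without. -/
theorem numConcepts_op {G M : Type*} [Finite G] {I : G → M → Prop} {g : G} {m : M}
    (hgm : ¬ I g m) : numConcepts (op I g m) = 2 * numConcepts (delete I g m) := by
  set 𝓕 := extents (deleteAttribute I m) with h𝓕
  have hfull : extents (deleteAttribute (op I g m) m) = insert g '' 𝓕 := by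
    simp only [h𝓕, extents, ← Set.range_comp]
    congr 1
    ext t h
    simp only [Function.comp_apply, mem_lowerPolar_iff, deleteAttribute, op, Set.mem_insert_iff]
    grind
  have hcol : {h | op I g m h m} = {g}ᶜ := by
    ext h
    simp only [op, Set.mem_ofPred_eq, Set.mem_compl_iff, Set.mem_singleton_iff]
    grind
  have htr : (· ∩ {g}ᶜ) '' (insert g '' 𝓕) = (· \ {g}) '' 𝓕 := by
    rw [Set.image_image]
    congr 1
    ext F h
    simp only [Set.mem_inter_iff, Set.mem_insert_iff, Set.mem_compl_iff, Set.mem_singleton_iff,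
      Set.mem_sdiff]
    grind
  have hins : insert g '' 𝓕 = insert g '' ((· \ {g}) '' 𝓕) := by
    rw [Set.image_image]
    congr 1
    ext F : 1
    exact Set.insert_sdiff_singleton.symm
  have hdisj : Disjoint (insert g '' 𝓕) ((· \ {g}) '' 𝓕) := by
    rw [Set.disjoint_left]
    rintro _ ⟨F, _, rfl⟩ ⟨F', _, he⟩
    have : g ∈ F' \ {g} := (Set.ext_iff.1 he g).2 (Set.mem_insert g F)
    exact this.2 rfl
  have hinj : Set.InjOn (insert g) ((· \ {g}) '' 𝓕) := by
    rintro _ ⟨F, _, rfl⟩ _ ⟨F', _, rfl⟩ he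
    simp only [Set.insert_sdiff_singleton] at he
    have := congrArg (· \ {g}) he
    simpa using this
  rw [numConcepts_eq_ncard_extents, extents_eq_union_traces _ m, hfull, hcol, htr,
    Set.ncard_union_eq hdisj (Set.toFinite _) (Set.toFinite _), hins, hinj.ncard_image,
    numConcepts_delete, two_mul]

end FormalContext

theorem mainTheorem1 {G M : Type*} [Finite G] (I : G → M → Prop) :
    (∀ m : M, ¬ FormalContext.IsFullColumn I m →
      ∃ g : G, ¬ I g m ∧
        FormalContext.numConcepts (FormalContext.op I g m) ≥ FormalContext.numConcepts I ∧
        FormalContext.IsRich I g m) ∧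
    ((∃ (g : G) (m : M), ¬ I g m) →
      ∃ (g : G) (m : M), ¬ I g m ∧ FormalContext.IsRich I g m) := by
  have key : ∀ m : M, ¬ FormalContext.IsFullColumn I m → ∃ g : G, ¬ I g m ∧
      FormalContext.numConcepts (FormalContext.op I g m) ≥ FormalContext.numConcepts I ∧
      FormalContext.IsRich I g m := by
    intro m hm
    obtain ⟨g, hg, hle⟩ := FormalContext.exists_card_union_traces_le
      (FormalContext.extents (FormalContext.deleteAttribute I m)) (A := {h | I h m})
      (fun h => hm (Set.eq_univ_iff_forall.1 h))
    rw [← FormalContext.extents_eq_union_traces, ← FormalContext.numConcepts_delete,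
      ← FormalContext.numConcepts_eq_ncard_extents] at hle
    have hgm : ¬ I g m := hg
    refine ⟨g, hgm, (FormalContext.numConcepts_op hgm).symm ▸ hle, ?_⟩
    have : (FormalContext.numConcepts I : ℚ) ≤
        2 * FormalContext.numConcepts (FormalContext.delete I g m) := by exact_mod_cast hle
    rw [FormalContext.IsRich]
    linarith
  refine ⟨key, fun ⟨g, m, hgm⟩ => ?_⟩
  obtain ⟨g', hg', -, hrich⟩ := key m fun h => hgm (h g)
  exact ⟨g', m, hg', hrich⟩
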